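/- Let $R$ be an associative ring with identity, not necessarily commutative. A submodule $X$ of a module $M$ is essential in a submodule $Y\supseteq X$ if every nonzero submodule of $Y$ meets $X$ nontrivially; it is closed in $M$ if it is essential in no submodule of $M$ other than itself. The ring $R$ is: - right nonsingular if $x=0$ is the only $x\in R$ whose right annihilator $\{r\in R: xr=0\}$ is an essential right ideal; - right CS if every closed right ideal is a direct summand of $R_R$; - right Utumi if every right ideal $I$ with zero left annihilator $\{r\in R: rI=0\}$ is essential in $R_R$; - right Goldie if $R_R$ has finite uniform dimension and $R$ satisfies the ascending chain condition on right annihilators of subsets of $R$. Here a module has finite uniform dimension if it contains no direct sum of infinitely many nonzero submodules. Left nonsingular, left CS, left Utumi and left Goldie are defined by interchanging left and right throughout. Theorem. The following are equivalent: (1) $R$ is right nonsingular, right CS and left Utumi; (2) $R$ is left nonsingular, left CS and right Utumi. In this case, if $R_R$ or ${}_RR$ has finite uniform dimension, then $R$ is both right Goldie and left Goldie. -/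

import Mathlib

namespace SymCS

section Modules

variable {A M : Type*} [Ring A] [AddCommGroup M] [Module A M]

/-- `X` is an essential submodule of the submodule `Y`: `X ≤ Y` and every submodule of `Y` that
meets `X` trivially is zero. -/
def EssentialIn (X Y : Submodule A M) : Prop :=
  X ≤ Y ∧ ∀ Z : Submodule A M, Z ≤ Y → X ⊓ Z = ⊥ → Z = ⊥

/-- `X` is an essential submodule of the whole module. -/
def Essential (X : Submodule A M) : Prop :=
  EssentialIn X ⊤

/-- `X` is a closed submodule: it has no proper essential extension inside the module. -/
def ClosedSubmodule (X : Submodule A M) : Prop :=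
  ∀ Y : Submodule A M, EssentialIn X Y → X = Y

end Modules

section ModuleConditions

variable (A M : Type*) [Ring A] [AddCommGroup M] [Module A M]

/-- CS (extending) module: every closed submodule is a direct summand. -/
def IsCSModule : Prop :=
  ∀ X : Submodule A M, ClosedSubmodule X → ∃ Y : Submodule A M, IsCompl X Y

/-- Finite uniform dimension: there is no infinite direct sum of nonzero submodules.  (Every
infinite family contains a countably infinite one, so families indexed by `ℕ` suffice.) -/
def HasFiniteUniformDimension : Prop :=
  ¬ ∃ N : ℕ → Submodule A M, iSupIndep N ∧ ∀ i, N i ≠ ⊥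

end ModuleConditions

section Rings

/-! The right module `R_R` is `R` as a module over `Rᵐᵒᵖ`, so right ideals of `R` are terms of
`Submodule Rᵐᵒᵖ R`, and left ideals are terms of `Submodule R R`. -/

variable {R : Type*} [Ring R]

/-- The right annihilator `{r | t r = 0 for all t ∈ T}`, a right ideal. -/
def rightAnn (T : Set R) : Submodule Rᵐᵒᵖ R where
  carrier := {r | ∀ t ∈ T, t * r = 0}
  add_mem' := fun {a b} ha hb t ht => by rw [mul_add, ha t ht, hb t ht, add_zero]
  zero_mem' := fun t _ => mul_zero t
  smul_mem' := fun c x hx t ht => by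
    rw [← MulOpposite.op_unop c, op_smul_eq_mul, ← mul_assoc, hx t ht, zero_mul]

/-- The left annihilator `{r | r t = 0 for all t ∈ T}`, a left ideal. -/
def leftAnn (T : Set R) : Submodule R R where
  carrier := {r | ∀ t ∈ T, r * t = 0}
  add_mem' := fun {a b} ha hb t ht => by rw [add_mul, ha t ht, hb t ht, add_zero]
  zero_mem' := fun t _ => zero_mul t
  smul_mem' := fun c x hx t ht => by
    rw [smul_eq_mul, mul_assoc, hx t ht, mul_zero]

variable (R)

/-- Right nonsingular: the right singular ideal `{x | r(x) is essential in R_R}` is zero. -/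
def IsRightNonsingular : Prop :=
  ∀ x : R, Essential (rightAnn {x}) → x = 0

/-- Left nonsingular: the left singular ideal `{x | l(x) is essential in _RR}` is zero. -/
def IsLeftNonsingular : Prop :=
  ∀ x : R, Essential (leftAnn {x}) → x = 0

/-- Right CS: every closed right ideal is a direct summand of `R_R`. -/
def IsRightCS : Prop := IsCSModule Rᵐᵒᵖ R

/-- Left CS: every closed left ideal is a direct summand of `_RR`. -/
def IsLeftCS : Prop := IsCSModule R R

/-- Right Utumi: every right ideal with zero left annihilator is essential in `R_R`. -/
def IsRightUtumi : Prop :=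
  ∀ I : Submodule Rᵐᵒᵖ R, leftAnn (I : Set R) = ⊥ → Essential I

/-- Left Utumi: every left ideal with zero right annihilator is essential in `_RR`. -/
def IsLeftUtumi : Prop :=
  ∀ I : Submodule R R, rightAnn (I : Set R) = ⊥ → Essential I

/-- Right Goldie: finite right uniform dimension, and every ascending chain of right annihilators
of subsets of `R` becomes stationary. -/
def IsRightGoldie : Prop :=
  HasFiniteUniformDimension Rᵐᵒᵖ R ∧
    ∀ f : ℕ → Submodule Rᵐᵒᵖ R, Monotone f → (∀ n, ∃ T : Set R, f n = rightAnn T) →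
      ∃ n, ∀ m, n ≤ m → f m = f n

/-- Left Goldie: finite left uniform dimension, and every ascending chain of left annihilators
of subsets of `R` becomes stationary. -/
def IsLeftGoldie : Prop :=
  HasFiniteUniformDimension R R ∧
    ∀ f : ℕ → Submodule R R, Monotone f → (∀ n, ∃ T : Set R, f n = leftAnn T) →
      ∃ n, ∀ m, n ≤ m → f m = f n

end Rings

end SymCS

namespace SymCS

/-! ### Essentiality and complements in modular lattices. -/

section Lattice

variable {L : Type*} [CompleteLattice L]

/-! Right and left ideals form modular lattices joined by the annihilator Galois connection, which
preserves complements because 1 splits along a decomposition. The pivot is the Baer condition: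
annihilators are summands. Right nonsingularity and right CS give it; it is left-right symmetric and
yields left nonsingularity, while right CS alone yields right Utumi. With left Utumi, each left
ideal is essential in its double annihilator, so closed left ideals are annihilators, hence
summands. For Goldie, chains of annihilators are chains of summands, and applying this to
annihilators of tails of an independent family transfers finite dimension across sides. -/

/-- The lattice-theoretic form of `EssentialIn`. -/
def LatticeEssential (a b : L) : Prop :=
  a ≤ b ∧ ∀ z ≤ b, a ⊓ z = ⊥ → z = ⊥

/-- The lattice-theoretic form of the extending condition. -/
def LatticeCS (L : Type*) [CompleteLattice L] : Prop :=
  ∀ a : L, (∀ b, LatticeEssential a b → a = b) → ∃ c, IsCompl a c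

/-- The lattice-theoretic form of finite uniform dimension. -/
def LatticeFiniteUniformDimension (L : Type*) [CompleteLattice L] : Prop :=
  ¬ ∃ N : ℕ → L, iSupIndep N ∧ ∀ i, N i ≠ ⊥

theorem LatticeEssential.refl (a : L) : LatticeEssential a a :=
  ⟨le_rfl, fun z hz h => by rwa [inf_eq_right.2 hz] at h⟩

theorem LatticeEssential.trans {a b c : L} (hab : LatticeEssential a b)
    (hbc : LatticeEssential b c) : LatticeEssential a c :=
  ⟨hab.1.trans hbc.1, fun z hz h => hbc.2 z hz <| hab.2 _ inf_le_left <| by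
    rwa [← inf_assoc, inf_eq_left.2 hab.1]⟩

theorem LatticeEssential.mono_top {a b : L} (hab : a ≤ b) (ha : LatticeEssential a ⊤) :
    LatticeEssential b ⊤ :=
  ⟨le_top, fun z hz h => ha.2 z hz (le_bot_iff.1 ((inf_le_inf_right z hab).trans h.le))⟩

/-- Every element has a maximal essential extension, which is then closed. -/
theorem exists_closed_essential_extension [IsCompactlyGenerated L] (a : L) :
    ∃ c, LatticeEssential a c ∧ ∀ b, LatticeEssential c b → c = b := by
  obtain ⟨m, -, hm⟩ := zorn_le_nonempty₀ {b | LatticeEssential a b} (fun C hC hchain y hy => by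
    refine ⟨sSup C, ⟨(hC hy).1.trans (le_sSup hy), fun z hz h => ?_⟩, fun z hz => le_sSup hz⟩
    have hdir : DirectedOn (· ≤ ·) C := hchain.directedOn
    rw [← inf_eq_left.2 hz, hdir.inf_sSup_eq]
    simp only [iSup_eq_bot]
    intro b hb
    refine (hC hb).2 _ inf_le_right ?_
    rw [← inf_assoc, h, bot_inf_eq]) a (LatticeEssential.refl a)
  exact ⟨m, hm.prop, fun b hb => le_antisymm hb.1 (hm.le_of_ge (hm.prop.trans hb) hb.1)⟩

variable [IsModularLattice L]

theorem LatticeEssential.sup_compl {a c d : L} (h : LatticeEssential a c) (hcd : IsCompl c d) :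
    LatticeEssential (a ⊔ d) ⊤ := by
  refine ⟨le_top, fun z _ hz => ?_⟩
  have had : Disjoint a d := hcd.disjoint.mono_left h.1
  have h1 : Disjoint a (d ⊔ z) := had.disjoint_sup_right_of_disjoint_sup_left
    (disjoint_iff.2 hz)
  have h2 : (d ⊔ z) ⊓ c = ⊥ := h.2 _ inf_le_right <| by
    rw [← inf_assoc, h1.eq_bot, bot_inf_eq]
  -- Modularity: `d` already complements `c`, so a larger element disjoint from `c` equals `d`.
  have h3 : d = d ⊔ z := eq_of_le_of_inf_le_of_sup_le (z := c) le_sup_left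
    (by rw [h2]; exact bot_le) (by rw [hcd.symm.sup_eq_top]; exact le_top)
  have hzd : z ≤ d := by rw [h3]; exact le_sup_right
  rw [← hz, eq_comm, inf_eq_right]
  exact hzd.trans le_sup_right

/-- If `x ≤ y`, `y` is disjoint from `d` and `x ⊔ d` is essential, then `x` is essential in
`y`. -/
theorem LatticeEssential.of_sup {x y d : L} (hxy : x ≤ y) (hyd : Disjoint y d)
    (h : LatticeEssential (x ⊔ d) ⊤) : LatticeEssential x y := by
  refine ⟨hxy, fun z hz hxz => h.2 z le_top ?_⟩
  have h1 : (x ⊔ d) ⊓ y = x := by rw [sup_inf_assoc_of_le d hxy, hyd.symm.eq_bot, sup_bot_eq]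
  rw [← inf_eq_right.2 hz, ← inf_assoc, h1, hxz]

/-- All earlier `D k` lie below `f n`, which `D n` avoids. -/
theorem iSupIndep_of_disjoint_monotone [IsCompactlyGenerated L] {f D : ℕ → L} (hf : Monotone f)
    (hD : ∀ n, D n ≤ f (n + 1)) (hdisj : ∀ n, Disjoint (D n) (f n)) : iSupIndep D := by
  have hle : ∀ N, (Finset.range N).sup D ≤ f N := fun N => Finset.sup_le fun k hk =>
    (hD k).trans (hf (Finset.mem_range.1 hk))
  have hind : ∀ N, (Finset.range N).SupIndep D := by
    intro N
    induction N with
    | zero => exact Finset.supIndep_empty D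
    | succ N ih =>
      rw [Finset.range_add_one]
      exact ih.insert ((hdisj N).mono_right (hle N))
  intro n
  have hsup : ⨆ (j) (_ : j ≠ n), D j ≤ ⨆ N, ((Finset.range N).erase n).sup D :=
    iSup₂_le fun j hj => le_iSup_of_le (j + 1) (Finset.le_sup (by simp [hj]))
  refine Disjoint.mono_right hsup ?_
  have hmono : Monotone fun N => ((Finset.range N).erase n).sup D := fun a b hab =>
    Finset.sup_mono (Finset.erase_subset_erase n (Finset.range_mono hab))
  rw [hmono.directed_le.disjoint_iSup_right]
  intro N
  -- The range must also contain `n` itself.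
  have := hind (max N (n + 1))
  exact this ((Finset.erase_subset _ _).trans (Finset.range_mono (le_max_left _ _)))
    (by simp) (Finset.notMem_erase n _)

/-- With finite uniform dimension, ascending chains of complemented elements stabilize. -/
theorem LatticeFiniteUniformDimension.chain_stabilizes [IsCompactlyGenerated L]
    (hL : LatticeFiniteUniformDimension L) {f : ℕ → L} (hf : Monotone f)
    (hc : ∀ n, ∃ c, IsCompl (f n) c) : ∃ n, ∀ m, n ≤ m → f m = f n := by
  by_contra! hne
  choose c hc using hc
  have hind : iSupIndep fun n => c n ⊓ f (n + 1) :=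
    iSupIndep_of_disjoint_monotone hf (fun n => inf_le_right)
      fun n => (hc n).symm.disjoint.mono_left inf_le_left
  have hstep : ∀ n, c n ⊓ f (n + 1) = ⊥ → f (n + 1) = f n := fun n h => by
    have := sup_inf_assoc_of_le (c n) (hf n.le_succ)
    rwa [(hc n).sup_eq_top, top_inf_eq, Nat.succ_eq_add_one, h, sup_bot_eq] at this
  -- Some differences may vanish, so only a subsequence is kept.
  have hfreq : ∃ᶠ n in Filter.atTop, c n ⊓ f (n + 1) ≠ ⊥ := by
    rw [Filter.frequently_atTop]
    intro n
    by_contra! h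
    obtain ⟨m, hnm, hm⟩ := hne n
    refine hm (Nat.le_induction rfl (fun k hk ih => ?_) m hnm)
    rw [hstep k (h k hk), ih]
  obtain ⟨φ, hφ, hφ'⟩ := Filter.extraction_of_frequently_atTop hfreq
  exact hL ⟨_, hind.comp hφ.injective, hφ'⟩

end Lattice

/-! ### Annihilator pairings and the Baer condition. -/

/-- An antitone Galois connection between two complete lattices whose maps both carry
complements to complements, modelled on the left and right annihilators of one-sided ideals. -/
structure AnnihilatorPairing (L L' : Type*) [CompleteLattice L] [CompleteLattice L'] where
  /-- The map modelled on the left annihilator. -/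
  l : L → L'
  /-- The map modelled on the right annihilator. -/
  r : L' → L
  le_iff : ∀ a b, a ≤ r b ↔ b ≤ l a
  isCompl_l : ∀ a b, IsCompl a b → IsCompl (l a) (l b)
  isCompl_r : ∀ a b, IsCompl a b → IsCompl (r a) (r b)

namespace AnnihilatorPairing

variable {L L' : Type*} [CompleteLattice L] [CompleteLattice L'] (P : AnnihilatorPairing L L')

/-- Interchange the two sides of an annihilator pairing. -/
def symm : AnnihilatorPairing L' L where
  l := P.r
  r := P.l
  le_iff a b := (P.le_iff b a).symm
  isCompl_l := P.isCompl_r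
  isCompl_r := P.isCompl_l

/-- Nonsingularity: only `⊥` has an essential annihilator. -/
def Nonsingular : Prop :=
  ∀ b, LatticeEssential (P.r b) ⊤ → b = ⊥

/-- The Utumi condition: elements with trivial annihilator are essential. -/
def Utumi : Prop :=
  ∀ a, P.l a = ⊥ → LatticeEssential a ⊤

/-- The Baer condition: annihilators are complemented. -/
def Baer : Prop :=
  ∀ b, ∃ c, IsCompl (P.r b) c

theorem le_r_l (a : L) : a ≤ P.r (P.l a) := (P.le_iff _ _).2 le_rfl

theorem l_antitone : Antitone P.l := fun _ _ h => (P.le_iff _ _).1 (h.trans (P.le_r_l _))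

theorem l_r_l (a : L) : P.l (P.r (P.l a)) = P.l a :=
  le_antisymm (P.l_antitone (P.le_r_l a)) (P.symm.le_r_l (P.l a))

theorem r_antitone : Antitone P.r := P.symm.l_antitone

theorem l_sup (a b : L) : P.l (a ⊔ b) = P.l a ⊓ P.l b :=
  eq_of_forall_le_iff fun c => by
    rw [← P.le_iff, sup_le_iff, le_inf_iff, P.le_iff, P.le_iff]

theorem r_top : P.r ⊤ = ⊥ := by
  have h := P.isCompl_r ⊤ ⊥ isCompl_top_bot
  have h1 : P.r ⊥ = ⊤ := top_le_iff.1 ((P.le_iff _ _).2 bot_le)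
  rw [h1] at h
  rw [← h.inf_eq_bot, inf_top_eq]

variable {P}

/-- `l` carries a complement of `r (l a)` to one of `l (r (l a)) = l a`. -/
theorem Baer.symm (h : P.Baer) : P.symm.Baer := fun a => by
  obtain ⟨c, hc⟩ := h (P.l a)
  refine ⟨P.l c, ?_⟩
  have := P.isCompl_l _ _ hc
  rwa [P.l_r_l] at this

theorem Baer.nonsingular_symm (h : P.Baer) : P.symm.Nonsingular := fun a ha => by
  obtain ⟨c, hc⟩ := h (P.l a)
  have hl := P.isCompl_l _ _ hc
  rw [P.l_r_l] at hl
  have h1 : P.l c = ⊥ := ha.2 _ le_top hl.inf_eq_bot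
  have h2 : P.l a = ⊤ := by rw [← hl.sup_eq_top, h1, sup_bot_eq]
  rw [← le_bot_iff, ← P.r_top, ← h2]
  exact P.le_r_l a

theorem utumi_of_latticeCS [IsCompactlyGenerated L] (h : LatticeCS L) : P.Utumi := fun a ha => by
  obtain ⟨c, hac, hc⟩ := exists_closed_essential_extension a
  obtain ⟨d, hd⟩ := h c hc
  have hlc : P.l c = ⊥ := le_bot_iff.1 ((P.l_antitone hac.1).trans ha.le)
  have hld : P.l d = ⊤ := by
    rw [← (P.isCompl_l _ _ hd).sup_eq_top, hlc, bot_sup_eq]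
  have hd0 : d = ⊥ := by
    rw [← le_bot_iff, ← P.r_top, ← hld]
    exact P.le_r_l d
  have hc1 : c = ⊤ := by rw [← hd.sup_eq_top, hd0, sup_bot_eq]
  rwa [← hc1]

theorem baer_of_nonsingular_of_latticeCS [IsModularLattice L] [IsModularLattice L']
    [IsCompactlyGenerated L] (hP : P.Nonsingular) (h : LatticeCS L) : P.Baer := fun b => by
  obtain ⟨c, hac, hc⟩ := exists_closed_essential_extension (P.r b)
  obtain ⟨d, hd⟩ := h c hc
  have hess := (hac.sup_compl hd).mono_top (P.le_r_l _)
  have hbot := hP _ hess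
  rw [P.l_sup] at hbot
  have hlc := P.isCompl_l _ _ hd
  -- Both are complements of `P.l d` and they are comparable, so modularity makes them equal.
  have heq : P.l c = P.l (P.r b) := by
    refine eq_of_le_of_inf_le_of_sup_le (z := P.l d) (P.l_antitone hac.1) ?_ ?_
    · rw [hbot]; exact bot_le
    · rw [hlc.sup_eq_top]; exact le_top
  have hcb : c = P.r b := le_antisymm
    ((P.le_iff _ _).2 (heq ▸ P.symm.le_r_l b)) hac.1
  exact ⟨d, hcb ▸ hd⟩

/-- Under the Baer and opposite Utumi conditions, every element is essential in its double
annihilator. -/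
theorem Baer.essential_l_r [IsModularLattice L'] (h : P.Baer) (hU : P.symm.Utumi) (x : L') :
    LatticeEssential x (P.l (P.r x)) := by
  obtain ⟨c, hc⟩ := h x
  have hl := P.isCompl_l _ _ hc
  have hr := P.isCompl_r _ _ hl
  rw [show P.r (P.l (P.r x)) = P.r x from P.symm.l_r_l x] at hr
  exact LatticeEssential.of_sup (P.symm.le_r_l x) hl.disjoint
    (hU _ ((P.symm.l_sup x (P.l c)).trans hr.inf_eq_bot))

theorem Baer.latticeCS_symm [IsModularLattice L'] (h : P.Baer) (hU : P.symm.Utumi) :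
    LatticeCS L' := fun x hx => by
  obtain ⟨c, hc⟩ := h.symm (P.r x)
  exact ⟨c, (hx _ (h.essential_l_r hU x)).symm ▸ hc⟩

theorem Baer.annihilator_chain_stabilizes [IsModularLattice L] [IsCompactlyGenerated L]
    (h : P.Baer) (hL : LatticeFiniteUniformDimension L) {f : ℕ → L} (hf : Monotone f)
    (hfr : ∀ n, ∃ b, f n = P.r b) : ∃ n, ∀ m, n ≤ m → f m = f n :=
  hL.chain_stabilizes hf fun n => by
    obtain ⟨b, hb⟩ := hfr n
    rw [hb]
    exact h b

theorem Baer.finiteUniformDimension_symm [IsModularLattice L] [IsCompactlyGenerated L]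
    [IsModularLattice L'] (h : P.Baer) (hU : P.symm.Utumi)
    (hL : LatticeFiniteUniformDimension L) : LatticeFiniteUniformDimension L' := by
  rintro ⟨N, hN, hne⟩
  -- Once the annihilators of the tails stabilize, the tail from `n + 1` is essential in an element
  -- containing `N n`, yet is disjoint from `N n`.
  obtain ⟨n, hn⟩ := h.annihilator_chain_stabilizes hL (f := fun n => P.r (⨆ k ≥ n, N k))
    (fun a b hab => P.r_antitone (iSup₂_le fun k hk => le_iSup₂_of_le k (hab.trans hk) le_rfl))
    (fun n => ⟨_, rfl⟩)
  have h1 : P.r (⨆ k ≥ n + 1, N k) = P.r (⨆ k ≥ n, N k) := hn (n + 1) n.le_succ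
  have hess := h.essential_l_r hU (⨆ k ≥ n + 1, N k)
  rw [h1] at hess
  refine hne n (hess.2 (N n) ?_ ?_)
  · exact (le_iSup₂_of_le (f := fun k (_ : k ≥ n) => N k) n le_rfl le_rfl).trans
      (P.symm.le_r_l _)
  · refine ((hN n).mono_right (iSup₂_le fun k hk => ?_)).symm.eq_bot
    exact le_iSup₂_of_le (f := fun k (_ : k ≠ n) => N k) k (by omega) le_rfl

end AnnihilatorPairing

/-! ### Annihilators of one-sided ideals. -/

section Rings

variable {R : Type*} [Ring R]

/-- Decomposing `1` along complementary right ideals gives complementary left annihilators. -/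
theorem isCompl_leftAnn {A B : Submodule Rᵐᵒᵖ R} (h : IsCompl A B) :
    IsCompl (leftAnn (A : Set R)) (leftAnn (B : Set R)) := by
  obtain ⟨e, he, f, hf, hef⟩ := Submodule.mem_sup.1
    (show (1 : R) ∈ A ⊔ B by rw [h.sup_eq_top]; trivial)
  have hmul : ∀ {C : Submodule Rᵐᵒᵖ R} {x : R}, x ∈ C → ∀ y, x * y ∈ C := fun {C} _ hx y =>
    C.smul_mem (MulOpposite.op y) hx
  have hdis := Submodule.disjoint_def.1 h.disjoint
  have hfa : ∀ a ∈ A, f * a = 0 := fun a ha => hdis _ (by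
    have : f * a = a - e * a := by rw [eq_sub_iff_add_eq', ← add_mul, hef, one_mul]
    rw [this]; exact A.sub_mem ha (hmul he a)) (hmul hf a)
  have heb : ∀ b ∈ B, e * b = 0 := fun b hb => hdis _ (hmul he b) (by
    have : e * b = b - f * b := by rw [eq_sub_iff_add_eq, ← add_mul, hef, one_mul]
    rw [this]; exact B.sub_mem hb (hmul hf b))
  refine ⟨Submodule.disjoint_def.2 fun x hxA hxB => ?_, codisjoint_iff.2 ?_⟩
  · rw [← mul_one x, ← hef, mul_add, hxA e he, hxB f hf, add_zero]
  · refine eq_top_iff.2 fun x _ => Submodule.mem_sup.2 ⟨x * f, ?_, x * e, ?_, ?_⟩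
    · intro a ha; rw [mul_assoc, hfa a ha, mul_zero]
    · intro b hb; rw [mul_assoc, heb b hb, mul_zero]
    · rw [← mul_add, add_comm f, hef, mul_one]

/-- Decomposing `1` along complementary left ideals gives complementary right annihilators. -/
theorem isCompl_rightAnn {A B : Submodule R R} (h : IsCompl A B) :
    IsCompl (rightAnn (A : Set R)) (rightAnn (B : Set R)) := by
  obtain ⟨e, he, f, hf, hef⟩ := Submodule.mem_sup.1
    (show (1 : R) ∈ A ⊔ B by rw [h.sup_eq_top]; trivial)
  have hmul : ∀ {C : Submodule R R} {x : R}, x ∈ C → ∀ y, y * x ∈ C := fun {C} _ hx y =>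
    C.smul_mem y hx
  have hdis := Submodule.disjoint_def.1 h.disjoint
  have haf : ∀ a ∈ A, a * f = 0 := fun a ha => hdis _ (by
    have : a * f = a - a * e := by rw [eq_sub_iff_add_eq', ← mul_add, hef, mul_one]
    rw [this]; exact A.sub_mem ha (hmul he a)) (hmul hf a)
  have hbe : ∀ b ∈ B, b * e = 0 := fun b hb => hdis _ (hmul he b) (by
    have : b * e = b - b * f := by rw [eq_sub_iff_add_eq, ← mul_add, hef, mul_one]
    rw [this]; exact B.sub_mem hb (hmul hf b))
  refine ⟨Submodule.disjoint_def.2 fun x hxA hxB => ?_, codisjoint_iff.2 ?_⟩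
  · rw [← one_mul x, ← hef, add_mul, hxA e he, hxB f hf, add_zero]
  · refine eq_top_iff.2 fun x _ => Submodule.mem_sup.2 ⟨f * x, ?_, e * x, ?_, ?_⟩
    · intro a ha; rw [← mul_assoc, haf a ha, zero_mul]
    · intro b hb; rw [← mul_assoc, hbe b hb, zero_mul]
    · rw [← add_mul, add_comm f, hef, one_mul]

variable (R) in
/-- The annihilator pairing between the right ideals and the left ideals of a ring. -/
def annihilatorPairing : AnnihilatorPairing (Submodule Rᵐᵒᵖ R) (Submodule R R) where
  l A := leftAnn (A : Set R)
  r B := rightAnn (B : Set R)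
  le_iff _ _ := ⟨fun h _ hb _ ha => h ha _ hb, fun h _ ha _ hb => h hb _ ha⟩
  isCompl_l _ _ := isCompl_leftAnn
  isCompl_r _ _ := isCompl_rightAnn

/-- Bridges the ring definitions, stated for elements and subsets, and the pairing, which sees only
ideals. -/
theorem rightAnn_span (T : Set R) :
    rightAnn (Submodule.span R T : Set R) = rightAnn T :=
  le_antisymm (fun _ hx t ht => hx t (Submodule.subset_span ht)) fun x hx y hy => by
    have : Submodule.span R T ≤ leftAnn {x} := Submodule.span_le.2 fun t ht z hz => by
      rw [Set.mem_singleton_iff.1 hz]; exact hx t ht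
    exact this hy x rfl

theorem leftAnn_span (T : Set R) :
    leftAnn (Submodule.span Rᵐᵒᵖ T : Set R) = leftAnn T :=
  le_antisymm (fun _ hx t ht => hx t (Submodule.subset_span ht)) fun x hx y hy => by
    have : Submodule.span Rᵐᵒᵖ T ≤ rightAnn {x} := Submodule.span_le.2 fun t ht z hz => by
      rw [Set.mem_singleton_iff.1 hz]; exact hx t ht
    exact this hy x rfl

theorem nonsingular_annihilatorPairing_iff :
    (annihilatorPairing R).Nonsingular ↔ IsRightNonsingular R := by
  refine ⟨fun h x hx => ?_, fun h B hB => (Submodule.eq_bot_iff _).2 fun x hx => h x ?_⟩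
  · rw [← rightAnn_span] at hx
    exact Submodule.span_singleton_eq_bot.1 (h _ hx)
  · exact LatticeEssential.mono_top (fun y hy t ht => by
      rw [Set.mem_singleton_iff.1 ht]; exact hy x hx) hB

theorem nonsingular_symm_annihilatorPairing_iff :
    (annihilatorPairing R).symm.Nonsingular ↔ IsLeftNonsingular R := by
  refine ⟨fun h x hx => ?_, fun h B hB => (Submodule.eq_bot_iff _).2 fun x hx => h x ?_⟩
  · rw [← leftAnn_span] at hx
    exact Submodule.span_singleton_eq_bot.1 (h _ hx)
  · exact LatticeEssential.mono_top (fun y hy t ht => by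
      rw [Set.mem_singleton_iff.1 ht]; exact hy x hx) hB

theorem baer_annihilatorPairing (h : IsRightNonsingular R) (hCS : IsRightCS R) :
    (annihilatorPairing R).Baer :=
  AnnihilatorPairing.baer_of_nonsingular_of_latticeCS
    (nonsingular_annihilatorPairing_iff.2 h) hCS

theorem leftConditions_of_rightConditions (h : IsRightNonsingular R ∧ IsRightCS R ∧ IsLeftUtumi R) :
    IsLeftNonsingular R ∧ IsLeftCS R ∧ IsRightUtumi R :=
  have hB := baer_annihilatorPairing h.1 h.2.1
  ⟨nonsingular_symm_annihilatorPairing_iff.1 hB.nonsingular_symm, hB.latticeCS_symm h.2.2,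
    AnnihilatorPairing.utumi_of_latticeCS (P := annihilatorPairing R) h.2.1⟩

theorem rightConditions_of_leftConditions (h : IsLeftNonsingular R ∧ IsLeftCS R ∧ IsRightUtumi R) :
    IsRightNonsingular R ∧ IsRightCS R ∧ IsLeftUtumi R :=
  have hB : (annihilatorPairing R).symm.Baer :=
    AnnihilatorPairing.baer_of_nonsingular_of_latticeCS
      (nonsingular_symm_annihilatorPairing_iff.2 h.1) h.2.1
  ⟨nonsingular_annihilatorPairing_iff.1 hB.nonsingular_symm, hB.latticeCS_symm h.2.2,
    AnnihilatorPairing.utumi_of_latticeCS (P := (annihilatorPairing R).symm) h.2.1⟩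

theorem isRightGoldie_of_baer (hB : (annihilatorPairing R).Baer)
    (hR : HasFiniteUniformDimension Rᵐᵒᵖ R) : IsRightGoldie R :=
  ⟨hR, fun _ hf hfr => hB.annihilator_chain_stabilizes hR hf fun n =>
    (hfr n).imp' (Submodule.span R) fun T hT => hT.trans (rightAnn_span T).symm⟩

theorem isLeftGoldie_of_baer (hB : (annihilatorPairing R).Baer)
    (hR : HasFiniteUniformDimension R R) : IsLeftGoldie R :=
  ⟨hR, fun _ hf hfr => hB.symm.annihilator_chain_stabilizes hR hf fun n =>
    (hfr n).imp' (Submodule.span Rᵐᵒᵖ) fun T hT => hT.trans (leftAnn_span T).symm⟩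

theorem goldie_of_finiteUniformDimension
    (h : IsRightNonsingular R ∧ IsRightCS R ∧ IsLeftUtumi R)
    (hd : HasFiniteUniformDimension Rᵐᵒᵖ R ∨ HasFiniteUniformDimension R R) :
    IsRightGoldie R ∧ IsLeftGoldie R := by
  have hB := baer_annihilatorPairing h.1 h.2.1
  rcases hd with hd | hd
  · exact ⟨isRightGoldie_of_baer hB hd,
      isLeftGoldie_of_baer hB (hB.finiteUniformDimension_symm h.2.2 hd)⟩
  · exact ⟨isRightGoldie_of_baer hB
      (hB.symm.finiteUniformDimension_symm (leftConditions_of_rightConditions h).2.2 hd),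
      isLeftGoldie_of_baer hB hd⟩

end Rings

end SymCS

theorem theorem3p5 (R : Type*) [Ring R] :
    ((SymCS.IsRightNonsingular R ∧ SymCS.IsRightCS R ∧ SymCS.IsLeftUtumi R) ↔
      (SymCS.IsLeftNonsingular R ∧ SymCS.IsLeftCS R ∧ SymCS.IsRightUtumi R)) ∧
    ((SymCS.IsRightNonsingular R ∧ SymCS.IsRightCS R ∧ SymCS.IsLeftUtumi R) →
      (SymCS.HasFiniteUniformDimension Rᵐᵒᵖ R ∨ SymCS.HasFiniteUniformDimension R R) →
      SymCS.IsRightGoldie R ∧ SymCS.IsLeftGoldie R) :=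
  ⟨⟨SymCS.leftConditions_of_rightConditions, SymCS.rightConditions_of_leftConditions⟩,
    SymCS.goldie_of_finiteUniformDimension⟩
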